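/- Let $k$ be a field and $\mathbb{P}^3=\mathrm{Proj}\,k[X_0,X_1,X_2,X_3]$. For integers $\boldsymbol a=(a_1,\dots,a_s)$ and $\boldsymbol b=(b_1,\dots,b_{s+1})$, a Horrocks monad of type $(\boldsymbol a,\boldsymbol b)$ is a complex of sheaves of modules on $\mathbb{P}^3$ $$\bigoplus_{i=1}^{s}\mathcal{O}(-a_i-1)\ \xrightarrow{\ \alpha\ }\ \bigoplus_{j=1}^{s+1}\bigl(\mathcal{O}(b_j)\oplus\mathcal{O}(-b_j-1)\bigr)\ \xrightarrow{\ \beta\ }\ \bigoplus_{i=1}^{s}\mathcal{O}(a_i)$$ with $\alpha$ injective and locally left invertible and $\beta$ surjective; its cohomology $\mathcal{E}=\ker\beta/\operatorname{im}\alpha$ is then a vector bundle of rank 2. The monad is positive if all $a_i>0$, and minimal if no entry of the matrices of homogeneous forms defining $\alpha$ and $\beta$ is a nonzero constant. Let $(\boldsymbol a,\boldsymbol b)$ be one of the following ten pairs (all of which satisfy $\sum_i a_i(a_i+1)-\sum_j b_j(b_j+1)=10$): $(2,2,1,1),(2,0,0,0,0)$; $(2,2,2),(2,1,0,0)$; $(2,2,2,1),(2,1,1,0,0)$;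 $(2,2,2,2),(3,1,0,0,0)$; $(2,2,2,2),(2,2,1,0,0)$; $(2,2,2,2),(2,1,1,1,1)$; $(3,2,2),(3,1,0,0)$; $(3,3),(3,1,0)$; $(3,3,2),(3,2,1,0)$; $(3,3,2),(4,0,0,0)$. If a positive minimal Horrocks monad of type $(\boldsymbol a,\boldsymbol b)$ exists and $\mathcal{E}$ is its cohomology, then $\mathcal{E}$ has a nonzero global section, and $\mathcal{E}$ is not a stable rank 2 bundle; that is, it is not true that $c_1(\mathcal F)/\operatorname{rk}\mathcal F<c_1(\mathcal{E})/\operatorname{rk}\mathcal{E}$ for every coherent subsheaf $\mathcal F\subset\mathcal{E}$ with $0<\operatorname{rk}\mathcal F<\operatorname{rk}\mathcal{E}$. -/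

import Mathlib

open CategoryTheory CategoryTheory.Limits AlgebraicGeometry TopologicalSpace Opposite

universe u

noncomputable section

namespace HorrocksMonads

section Twist

variable {A : Type u} [CommRing A] {σ : Type*} [SetLike σ A] [AddSubgroupClass σ A]
  (𝒜 : ℕ → σ) [GradedRing 𝒜]

/-- The localization of the graded ring at the homogeneous prime `x`. -/
abbrev LocalRingAt (x : ProjectiveSpectrum 𝒜) : Type u :=
  Localization.AtPrime x.asHomogeneousIdeal.toIdeal

/-- `f` is given on `U` by one fraction `r / s` with `r`, `s` homogeneous and
`deg r - deg s = d`, where `s` vanishes at no point of `U`. -/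
def IsFractionOfDegree (d : ℤ) {U : Opens (ProjectiveSpectrum.top 𝒜)}
    (f : ∀ x : U, LocalRingAt 𝒜 x.1) : Prop :=
  ∃ (i j : ℕ) (_ : (i : ℤ) = j + d) (r : 𝒜 i) (s : 𝒜 j)
    (s_nin : ∀ x : U, s.1 ∉ x.1.asHomogeneousIdeal),
    ∀ x : U, f x = Localization.mk r.1 ⟨s.1, s_nin x⟩

/-- Being a fraction of degree `d`, as a condition stable under restriction. -/
def fractionPrelocal (d : ℤ) :
    TopCat.PrelocalPredicate fun x : ProjectiveSpectrum.top 𝒜 => LocalRingAt 𝒜 x where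
  pred f := IsFractionOfDegree 𝒜 d f
  res := by rintro V U i f ⟨a, b, hab, r, s, h, w⟩; exact ⟨a, b, hab, r, s, (h <| i ·), (w <| i ·)⟩

/-- Being locally a fraction of degree `d`. -/
def locallyFraction (d : ℤ) :
    TopCat.LocalPredicate fun x : ProjectiveSpectrum.top 𝒜 => LocalRingAt 𝒜 x :=
  (fractionPrelocal 𝒜 d).sheafify

variable {𝒜}

/-- Some homogeneous element of positive degree does not vanish at a given point. -/
lemma exists_homogeneous_notMem (x : ProjectiveSpectrum 𝒜) :
    ∃ (m : ℕ) (s : A), 0 < m ∧ s ∈ 𝒜 m ∧ s ∉ x.asHomogeneousIdeal := by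
  classical
  by_contra! H
  refine x.not_irrelevant_le fun a ha => ?_
  rw [← DirectSum.sum_support_decompose 𝒜 a]
  refine Ideal.sum_mem _ fun m _ => ?_
  rcases Nat.eq_zero_or_pos m with rfl | hm
  · have h0 : GradedRing.proj 𝒜 0 a = 0 := (HomogeneousIdeal.mem_irrelevant_iff _ _).mp ha
    rw [GradedRing.proj_apply] at h0
    rw [h0]
    exact zero_mem _
  · exact H m _ hm (SetLike.coe_mem _)

lemma locallyFraction_zero (d : ℤ) (U : Opens (ProjectiveSpectrum.top 𝒜)) :
    (locallyFraction 𝒜 d).pred (0 : ∀ x : U, LocalRingAt 𝒜 x.1) := fun x => by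
  obtain ⟨m, s, hm, hs, hsx⟩ := exists_homogeneous_notMem (𝒜 := 𝒜) x.1
  have hle : (-d).toNat ≤ (-d).toNat * m := Nat.le_mul_of_pos_right _ hm
  refine ⟨U ⊓ ProjectiveSpectrum.basicOpen 𝒜 s, ⟨x.2, hsx⟩, Opens.infLELeft _ _,
    ((-d).toNat * m + d).toNat, (-d).toNat * m, by omega, ⟨0, zero_mem _⟩,
    ⟨s ^ (-d).toNat, by simpa using SetLike.pow_mem_graded (-d).toNat hs⟩,
    fun y hy => y.2.2 ((ProjectiveSpectrum.isPrime (y.1 : ProjectiveSpectrum 𝒜)).mem_of_pow_mem _ hy),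
    fun _ => (Localization.mk_zero _).symm⟩

lemma locallyFraction_add (d : ℤ) (U : Opens (ProjectiveSpectrum.top 𝒜))
    (a b : ∀ x : U, LocalRingAt 𝒜 x.1)
    (ha : (locallyFraction 𝒜 d).pred a) (hb : (locallyFraction 𝒜 d).pred b) :
    (locallyFraction 𝒜 d).pred (a + b) := fun x => by
  rcases ha x with ⟨Va, ma, ia, i, j, hij, ⟨ra, ra_mem⟩, ⟨sa, sa_mem⟩, hwa, wa⟩
  rcases hb x with ⟨Vb, mb, ib, i', j', hij', ⟨rb, rb_mem⟩, ⟨sb, sb_mem⟩, hwb, wb⟩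
  refine
    ⟨Va ⊓ Vb, ⟨ma, mb⟩, Opens.infLELeft _ _ ≫ ia, j' + i, j + j', by push_cast; omega,
      ⟨sb * ra + sa * rb,
        add_mem (SetLike.mul_mem_graded sb_mem ra_mem)
          ((by omega : j + i' = j' + i) ▸ SetLike.mul_mem_graded sa_mem rb_mem)⟩,
      ⟨sa * sb, SetLike.mul_mem_graded sa_mem sb_mem⟩, fun y ↦
        ProjectiveSpectrum.isPrime (y.1 : ProjectiveSpectrum 𝒜) |>.mul_notMem
          (hwa ⟨y.1, y.2.1⟩) (hwb ⟨y.1, y.2.2⟩), ?_⟩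
  rintro ⟨y, hy⟩
  have h1 := wa ⟨y, hy.1⟩
  have h2 := wb ⟨y, hy.2⟩
  change a _ + b _ = _
  refine (congrArg₂ (· + ·) h1 h2).trans ?_
  exact (Localization.add_mk _ _ _ _).trans (by rw [add_comm]; rfl)

lemma locallyFraction_neg (d : ℤ) (U : Opens (ProjectiveSpectrum.top 𝒜))
    (a : ∀ x : U, LocalRingAt 𝒜 x.1) (ha : (locallyFraction 𝒜 d).pred a) :
    (locallyFraction 𝒜 d).pred (-a) := fun x => by
  rcases ha x with ⟨V, m, i, p, q, h, ⟨r, r_mem⟩, ⟨s, s_mem⟩, nin, hy⟩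
  refine ⟨V, m, i, p, q, h, ⟨-r, neg_mem r_mem⟩, ⟨s, s_mem⟩, nin, fun y => ?_⟩
  have := hy y
  exact (congrArg Neg.neg this).trans (Localization.neg_mk _ _)

/-- A section of the structure sheaf times a local fraction of degree `d`. -/
lemma locallyFraction_smul (d : ℤ) (U : Opens (ProjectiveSpectrum.top 𝒜))
    (c : (ProjectiveSpectrum.Proj.structureSheaf 𝒜).1.obj (op U))
    (a : ∀ x : U, LocalRingAt 𝒜 x.1) (ha : (locallyFraction 𝒜 d).pred a) :
    (locallyFraction 𝒜 d).pred (fun x : U => (c.1 x).val * a x) := fun x => by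
  rcases c.2 x with ⟨Va, ma, ia, j, ⟨ra, ra_mem⟩, ⟨sa, sa_mem⟩, hwa, wa⟩
  rcases ha x with ⟨Vb, mb, ib, i', j', hij', ⟨rb, rb_mem⟩, ⟨sb, sb_mem⟩, hwb, wb⟩
  refine
    ⟨Va ⊓ Vb, ⟨ma, mb⟩, Opens.infLELeft _ _ ≫ ia, j + i', j + j', by push_cast; omega,
      ⟨ra * rb, SetLike.mul_mem_graded ra_mem rb_mem⟩,
      ⟨sa * sb, SetLike.mul_mem_graded sa_mem sb_mem⟩, fun y ↦
        ProjectiveSpectrum.isPrime (y.1 : ProjectiveSpectrum 𝒜) |>.mul_notMem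
          (hwa ⟨y.1, y.2.1⟩) (hwb ⟨y.1, y.2.2⟩), ?_⟩
  rintro ⟨y, hy⟩
  have h1 := wa ⟨y, hy.1⟩
  have h2 := wb ⟨y, hy.2⟩
  refine (congrArg₂ (· * ·) (congrArg HomogeneousLocalization.val h1) h2).trans ?_
  exact Localization.mk_mul _ _ _ _

/-- The sections over `U` of the `d`-th twist of the structure sheaf of `Proj 𝒜`: functions on `U`
with values in the localizations that are locally fractions of degree `d`. -/
def twistSections (d : ℤ) (U : Opens (ProjectiveSpectrum.top 𝒜)) :
    AddSubgroup (∀ x : U, LocalRingAt 𝒜 x.1) where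
  carrier := {f | (locallyFraction 𝒜 d).pred f}
  zero_mem' := locallyFraction_zero d U
  add_mem' := locallyFraction_add d U _ _
  neg_mem' := locallyFraction_neg d U _

variable (𝒜)

/-- The `d`-th twist as a presheaf of abelian groups. -/
def twistPresheaf (d : ℤ) : TopCat.Presheaf Ab (ProjectiveSpectrum.top 𝒜) where
  obj U := AddCommGrpCat.of (twistSections (𝒜 := 𝒜) d U.unop)
  map {U V} i := AddCommGrpCat.ofHom
    { toFun := fun f => ⟨fun x => f.1 (i.unop x), (locallyFraction 𝒜 d).res i.unop f.1 f.2⟩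
      map_zero' := rfl
      map_add' := fun _ _ => rfl }

lemma twistPresheaf_isSheaf (d : ℤ) : (twistPresheaf 𝒜 d).IsSheaf :=
  (TopCat.Presheaf.isSheaf_iff_isSheaf_comp (forget Ab) _).mpr
    (TopCat.Presheaf.isSheaf_of_iso
      (NatIso.ofComponents (fun _ => Iso.refl _) (by cat_disch) :
        (TopCat.subsheafToTypes (locallyFraction 𝒜 d)).1 ≅ twistPresheaf 𝒜 d ⋙ forget Ab)
      (TopCat.subsheafToTypes (locallyFraction 𝒜 d)).property)

/-- Sections of the structure sheaf act on sections of the twist by multiplication. -/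
instance twistModule (d : ℤ) (U : (Opens (ProjectiveSpectrum.top 𝒜))ᵒᵖ) :
    Module ((ProjectiveSpectrum.Proj.structureSheaf 𝒜).1.obj U)
      (twistSections (𝒜 := 𝒜) d U.unop) where
  smul c f := ⟨fun x => (c.1 x).val * f.1 x, locallyFraction_smul d _ c f.1 f.2⟩
  one_smul f := Subtype.ext (funext fun x => by
    let y : ProjectiveSpectrum 𝒜 := x.1
    have h : (1 : HomogeneousLocalization.AtPrime 𝒜 y.asHomogeneousIdeal.toIdeal).val = 1 :=
      HomogeneousLocalization.val_one
    exact (congrArg (· * f.1 x) h).trans (one_mul _))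
  mul_smul a b f := Subtype.ext (funext fun x => by
    change (a.1 x * b.1 x).val * f.1 x = (a.1 x).val * ((b.1 x).val * f.1 x)
    rw [HomogeneousLocalization.val_mul, mul_assoc])
  smul_zero a := Subtype.ext (funext fun x => mul_zero _)
  smul_add a f g := Subtype.ext (funext fun x => mul_add _ _ _)
  add_smul a b f := Subtype.ext (funext fun x => by
    change (a.1 x + b.1 x).val * f.1 x = (a.1 x).val * f.1 x + (b.1 x).val * f.1 x
    rw [HomogeneousLocalization.val_add, add_mul])
  zero_smul f := Subtype.ext (funext fun x => by
    let y : ProjectiveSpectrum 𝒜 := x.1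
    have h : (0 : HomogeneousLocalization.AtPrime 𝒜 y.asHomogeneousIdeal.toIdeal).val = 0 :=
      HomogeneousLocalization.val_zero
    exact (congrArg (· * f.1 x) h).trans (zero_mul _))

instance twistModule' (d : ℤ) (U : (Opens (Proj 𝒜))ᵒᵖ) :
    Module ((Proj 𝒜).ringCatSheaf.obj.obj U) ((twistPresheaf 𝒜 d).obj U) :=
  twistModule 𝒜 d U

/-- The sheaf of modules `𝒪(d)` on `Proj 𝒜`. -/
def twist (d : ℤ) : (Proj 𝒜).Modules where
  val := PresheafOfModules.ofPresheaf (R := (Proj 𝒜).ringCatSheaf.obj) (twistPresheaf 𝒜 d)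
    (by intro X Y f r m; rfl)
  isSheaf := twistPresheaf_isSheaf 𝒜 d

end Twist

section Space

attribute [local instance] MvPolynomial.gradedAlgebra

variable (k : Type u) [Field k]

/-- Projective three-space over `k`, as `Proj k[X₀, X₁, X₂, X₃]`. -/
abbrev P3 : Scheme.{u} := Proj (MvPolynomial.homogeneousSubmodule (Fin 4) k)

/-- The line bundle `𝒪(d)` on projective three-space. -/
abbrev lineBundle (d : ℤ) : (P3 k).Modules :=
  twist (MvPolynomial.homogeneousSubmodule (Fin 4) k) d

/-- `HasRankC1 F r c` says that the coherent sheaf `F` on projective three-space has rank `r` and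
first Chern class `c`. Both numbers are additive in short exact sequences and take the values
`1` and `d` on `𝒪(d)`; since every coherent sheaf on projective space has a finite resolution by
direct sums of sheaves `𝒪(d)`, these rules assign exactly one pair `(r, c)` to each coherent sheaf
(and none to a sheaf that is not coherent). -/
inductive HasRankC1 : (P3 k).Modules → ℤ → ℤ → Prop
  | lineBundle (d : ℤ) : HasRankC1 (lineBundle k d) 1 d
  | iso {F G : (P3 k).Modules} {r c : ℤ} (e : F ≅ G) (hF : HasRankC1 F r c) : HasRankC1 G r c
  | quotient (S : ShortComplex (P3 k).Modules) (hS : S.ShortExact) {r₁ c₁ r₂ c₂ : ℤ}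
      (h₁ : HasRankC1 S.X₁ r₁ c₁) (h₂ : HasRankC1 S.X₂ r₂ c₂) :
      HasRankC1 S.X₃ (r₂ - r₁) (c₂ - c₁)
  | extension (S : ShortComplex (P3 k).Modules) (hS : S.ShortExact) {r₁ c₁ r₃ c₃ : ℤ}
      (h₁ : HasRankC1 S.X₁ r₁ c₁) (h₃ : HasRankC1 S.X₃ r₃ c₃) :
      HasRankC1 S.X₂ (r₁ + r₃) (c₁ + c₃)
  | kernel (S : ShortComplex (P3 k).Modules) (hS : S.ShortExact) {r₂ c₂ r₃ c₃ : ℤ}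
      (h₂ : HasRankC1 S.X₂ r₂ c₂) (h₃ : HasRankC1 S.X₃ r₃ c₃) :
      HasRankC1 S.X₁ (r₂ - r₃) (c₂ - c₃)

/-- Slope stability (in the sense of Mumford and Takemoto) of a vector bundle `E`:
`c₁(F) / rk F < c₁(E) / rk E` for every coherent subsheaf `F` of `E` with `0 < rk F < rk E`. -/
def IsStable (E : (P3 k).Modules) : Prop :=
  ∀ r c : ℤ, HasRankC1 k E r c →
    ∀ (F : (P3 k).Modules) (i : F ⟶ E), Mono i →
      ∀ r' c' : ℤ, HasRankC1 k F r' c' → 0 < r' → r' < r → (c' : ℚ) / r' < (c : ℚ) / r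

/-- A morphism of sheaves of modules is locally left invertible if every point has an open
neighbourhood over which the morphism has a left inverse. -/
def IsLocallyLeftInvertible {X : Scheme.{u}} {M N : X.Modules} (f : M ⟶ N) : Prop :=
  ∀ x : X, ∃ U : X.Opens, x ∈ U ∧ IsSplitMono ((Scheme.Modules.restrictFunctor U.ι).map f)

section Monad

variable {s : ℕ} (a : Fin s → ℤ) (b : Fin (s + 1) → ℤ)

instance : HasFiniteBiproducts (P3 k).Modules := Abelian.hasFiniteBiproducts

/-- The left-hand term `⨁ᵢ 𝒪(-aᵢ - 1)`. -/
abbrev leftTerm : (P3 k).Modules := ⨁ fun i => lineBundle k (-a i - 1)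

/-- The middle term `⨁ⱼ (𝒪(bⱼ) ⊕ 𝒪(-bⱼ - 1))`. -/
abbrev middleTerm : (P3 k).Modules :=
  ⨁ fun j => lineBundle k (b j) ⊞ lineBundle k (-b j - 1)

/-- The right-hand term `⨁ᵢ 𝒪(aᵢ)`. -/
abbrev rightTerm : (P3 k).Modules := ⨁ fun i => lineBundle k (a i)

/-- A monad `⨁ᵢ 𝒪(-aᵢ - 1) ⟶ ⨁ⱼ (𝒪(bⱼ) ⊕ 𝒪(-bⱼ - 1)) ⟶ ⨁ᵢ 𝒪(aᵢ)` on projective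
three-space: a complex whose first map is injective and locally left invertible and whose second
map is surjective. -/
structure HorrocksMonad where
  α : leftTerm k a ⟶ middleTerm k b
  β : middleTerm k b ⟶ rightTerm k a
  comp_eq_zero : α ≫ β = 0
  mono_α : Mono α
  locallyLeftInvertible_α : IsLocallyLeftInvertible α
  epi_β : Epi β

namespace HorrocksMonad

variable {k a b} (M : HorrocksMonad k a b)

/-- The cohomology sheaf `ker β / im α`. -/
def cohomology : (P3 k).Modules := (ShortComplex.mk M.α M.β M.comp_eq_zero).homology

/-- The monad is positive: all `aᵢ` are positive. -/
def IsPositive (_ : HorrocksMonad k a b) : Prop := ∀ i, 0 < a i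

/-- The monad is minimal: no entry of the matrices of `α` and `β` is a nonzero constant. The entries
are morphisms `𝒪(m) ⟶ 𝒪(n)`, that is, forms of degree `n - m`, and such a form is a nonzero
constant exactly when the morphism is an isomorphism. -/
structure IsMinimal : Prop where
  left_fst : ∀ i j, ¬ IsIso (biproduct.ι (fun i => lineBundle k (-a i - 1)) i ≫ M.α ≫
    biproduct.π (fun j => lineBundle k (b j) ⊞ lineBundle k (-b j - 1)) j ≫ biprod.fst)
  left_snd : ∀ i j, ¬ IsIso (biproduct.ι (fun i => lineBundle k (-a i - 1)) i ≫ M.α ≫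
    biproduct.π (fun j => lineBundle k (b j) ⊞ lineBundle k (-b j - 1)) j ≫ biprod.snd)
  right_inl : ∀ j i, ¬ IsIso (biprod.inl ≫
    biproduct.ι (fun j => lineBundle k (b j) ⊞ lineBundle k (-b j - 1)) j ≫ M.β ≫
      biproduct.π (fun i => lineBundle k (a i)) i)
  right_inr : ∀ j i, ¬ IsIso (biprod.inr ≫
    biproduct.ι (fun j => lineBundle k (b j) ⊞ lineBundle k (-b j - 1)) j ≫ M.β ≫
      biproduct.π (fun i => lineBundle k (a i)) i)

end HorrocksMonad

end Monad

end Space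

/-- The ten pairs `(a, b)` with `∑ aᵢ (aᵢ + 1) - ∑ bⱼ (bⱼ + 1) = 10` that are to be excluded. -/
inductive IsExcludedPair : {s : ℕ} → (Fin s → ℤ) → (Fin (s + 1) → ℤ) → Prop
  | p1 : IsExcludedPair ![2, 2, 1, 1] ![2, 0, 0, 0, 0]
  | p2 : IsExcludedPair ![2, 2, 2] ![2, 1, 0, 0]
  | p3 : IsExcludedPair ![2, 2, 2, 1] ![2, 1, 1, 0, 0]
  | p4 : IsExcludedPair ![2, 2, 2, 2] ![3, 1, 0, 0, 0]
  | p5 : IsExcludedPair ![2, 2, 2, 2] ![2, 2, 1, 0, 0]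
  | p6 : IsExcludedPair ![2, 2, 2, 2] ![2, 1, 1, 1, 1]
  | p7 : IsExcludedPair ![3, 2, 2] ![3, 1, 0, 0]
  | p8 : IsExcludedPair ![3, 3] ![3, 1, 0]
  | p9 : IsExcludedPair ![3, 3, 2] ![3, 2, 1, 0]
  | p10 : IsExcludedPair ![3, 3, 2] ![4, 0, 0, 0]

end HorrocksMonads

end

noncomputable section

namespace HorrocksMonads

attribute [local instance] MvPolynomial.gradedAlgebra

section Modules

variable {X : Scheme.{u}} {M N : X.Modules}

/-- Morphisms of sheaves of modules commute with restriction. -/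
lemma app_map (χ : M ⟶ N) {U V : X.Opens} (i : V ⟶ U) (f : Γ(M, U)) :
    χ.app V (M.presheaf.map i.op f) = N.presheaf.map i.op (χ.app U f) :=
  congr($(χ.mapPresheaf.naturality i.op) f)

/-- Local left inverses in terms of sections. -/
lemma IsLocallyLeftInvertible.exists_retraction {α : M ⟶ N} (hα : IsLocallyLeftInvertible α)
    (x : X) :
    ∃ (V : X.Opens) (_ : x ∈ V)
      (ρ : ∀ W : (V : Scheme.{u}).Opens, Γ(N, V.ι ''ᵁ W) → Γ(M, V.ι ''ᵁ W)),
      (∀ W g, ρ W (α.app _ g) = g) ∧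
      (∀ W (c : Γ(X, V.ι ''ᵁ W)) n, ρ W (c • n) = c • ρ W n) ∧
      ∀ (W' W : (V : Scheme.{u}).Opens) (i : W' ⟶ W) n,
        ρ W' (N.presheaf.map (V.ι.opensFunctor.map i).op n) =
          M.presheaf.map (V.ι.opensFunctor.map i).op (ρ W n) := by
  obtain ⟨V, hx, ⟨⟨ρ, hρ⟩⟩⟩ := hα x
  refine ⟨V, hx, fun W n => ρ.app W n, fun W g => congr($(hρ).app W g), fun W c n => ?_,
    fun W' W i n => app_map ρ i n⟩
  have := ρ.app_smul ((V.ι.appIso W).hom c) n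
  have h {K : X.Modules} (n : Γ(K, V.ι ''ᵁ W)) :
      (show Γ(K.restrict V.ι, W) from (V.ι.appIso W).hom c • (show Γ(K.restrict V.ι, W) from n)) =
        (c • n : Γ(K, V.ι ''ᵁ W)) := by
    change (V.ι.appIso W).inv ((V.ι.appIso W).hom c) • n = c • n
    congr 1
    exact congr($((V.ι.appIso W).hom_inv_id) c)
  exact (congrArg (ρ.app W) (h n)).symm.trans (this.trans (h (K := M) _))

/-- A monomorphism is injective on sections. -/
lemma app_injective (χ : M ⟶ N) [Mono χ] (U : X.Opens) : Function.Injective (χ.app U) := by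
  have h : Mono χ.mapPresheaf := inferInstanceAs (Mono ((Scheme.Modules.toPresheaf X).map χ))
  have h' := (NatTrans.mono_iff_mono_app χ.mapPresheaf).mp h (op U)
  exact (AddCommGrpCat.mono_iff_injective _).mp h'

/-- A section of a finite direct sum is zero if its components are. -/
lemma biproduct_section_eq_zero {n : ℕ} (F : Fin n → X.Modules) [HasBiproduct F] {U : X.Opens} (g : Γ(⨁ F, U))
    (h : ∀ i, (biproduct.π F i).app U g = 0) : g = 0 := by
  have hsum : ∀ (s : Finset (Fin n)) (φ : Fin n → (⨁ F ⟶ ⨁ F)), (∀ i, (φ i).app U g = 0) →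
      (∑ i ∈ s, φ i).app U g = 0 := by
    intro s φ hφ
    induction s using Finset.cons_induction with
    | empty => rfl
    | cons i s hi ih =>
      rw [Finset.sum_cons, Scheme.Modules.Hom.add_app]
      exact (congrArg₂ (· + ·) (hφ i) ih).trans (add_zero _)
  have := hsum Finset.univ (fun i => biproduct.π F i ≫ biproduct.ι F i) fun i =>
    (congrArg ((biproduct.ι F i).app U) (h i)).trans (map_zero _)
  rwa [biproduct.total] at this

end Modules

section Points

open MvPolynomial

variable {k : Type u} [Field k]

/-- Some coordinate does not vanish at a given point of projective space. -/
lemma exists_X_notMem (x : ProjectiveSpectrum (homogeneousSubmodule (Fin 4) k)) :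
    ∃ i, (X i : MvPolynomial (Fin 4) k) ∉ x.asHomogeneousIdeal := by
  by_contra! H
  obtain ⟨m, s, hm, hs, hsx⟩ := exists_homogeneous_notMem x
  refine hsx ?_
  have hle : Ideal.span (X '' Set.univ) ≤ x.asHomogeneousIdeal.toIdeal := by
    rw [Ideal.span_le]
    rintro _ ⟨i, -, rfl⟩
    exact H i
  refine hle ((mem_ideal_span_X_image).mpr fun d hd => ?_)
  by_contra! h0
  have hd0 : d = 0 := Finsupp.ext fun i => h0 i trivial
  have := (mem_homogeneousSubmodule m s).mp hs (mem_support_iff.mp hd)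
  rw [hd0, map_zero] at this
  omega

/-- A power of a coordinate which does not vanish at a given point. -/
lemma exists_form_notMem (x : ProjectiveSpectrum (homogeneousSubmodule (Fin 4) k)) (n : ℕ) :
    ∃ ξ : homogeneousSubmodule (Fin 4) k n, ξ.1 ∉ x.asHomogeneousIdeal := by
  obtain ⟨i, hi⟩ := exists_X_notMem x
  exact ⟨⟨X i ^ n, (mem_homogeneousSubmodule _ _).mpr (isHomogeneous_X_pow i n)⟩,
    fun h => hi (x.isPrime.mem_of_pow_mem _ h)⟩

/-- A prime ideal of the coordinate ring which does not contain all coordinates gives a point of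
projective space at which the same forms vanish. -/
lemma exists_point_of_prime (I : Ideal (MvPolynomial (Fin 4) k)) (hI : I.IsPrime) (i : Fin 4)
    (hi : X i ∉ I) :
    ∃ x : ProjectiveSpectrum (homogeneousSubmodule (Fin 4) k),
      ∀ (n : ℕ), ∀ s ∈ homogeneousSubmodule (Fin 4) k n, s ∈ I → s ∈ x.asHomogeneousIdeal := by
  refine ⟨⟨I.homogeneousCore (homogeneousSubmodule (Fin 4) k), hI.homogeneousCore, fun h => ?_⟩,
    fun n s hs hsI => Ideal.mem_homogeneousCore_of_homogeneous_of_mem ⟨n, hs⟩ hsI⟩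
  have hX : X i ∈ HomogeneousIdeal.irrelevant (homogeneousSubmodule (Fin 4) k) := by
    rw [HomogeneousIdeal.mem_irrelevant_iff, GradedRing.proj_apply]
    exact DirectSum.decompose_of_mem_ne _
      ((mem_homogeneousSubmodule 1 _).mpr (isHomogeneous_X k i)) one_ne_zero
  exact hi (Ideal.toIdeal_homogeneousCore_le _ _ (h hX))

/-- A prime element of the coordinate ring does not divide all coordinates. -/
lemma exists_X_not_dvd (q : MvPolynomial (Fin 4) k) (hq : Prime q) : ∃ i, ¬ q ∣ X i := by
  by_contra! H
  have h := ((X_prime (R := k) (i := (0 : Fin 4))).irreducible.dvd_iff.mp (H 0)).resolve_left hq.not_isUnit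
  have := h.dvd.trans (H 1)
  rw [X_dvd_X] at this
  simp at this

/-- A rational function which near every point is a fraction of homogeneous polynomials whose
degrees differ by `d ≤ 0` is constant, and zero if `d < 0`. -/
lemma eq_C_mul_of_forall_point (p q : MvPolynomial (Fin 4) k) (hq : q ≠ 0) (d : ℤ) (hd : d ≤ 0)
    (H : ∀ x : ProjectiveSpectrum (homogeneousSubmodule (Fin 4) k),
      ∃ (i j : ℕ) (r : homogeneousSubmodule (Fin 4) k i) (s : homogeneousSubmodule (Fin 4) k j),
        (i : ℤ) = j + d ∧ s.1 ∉ x.asHomogeneousIdeal ∧ r.1 * q = p * s.1) :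
    ∃ c : k, p = C c * q ∧ (d < 0 → c = 0) := by
  obtain ⟨p', q', g, hrel, rfl, rfl⟩ :=
    UniqueFactorizationMonoid.exists_reduced_factors' p q hq
  have hg : g ≠ 0 := left_ne_zero_of_mul hq
  have hq' : q' ≠ 0 := right_ne_zero_of_mul hq
  have H' : ∀ x : ProjectiveSpectrum (homogeneousSubmodule (Fin 4) k),
      ∃ (i j : ℕ) (r : homogeneousSubmodule (Fin 4) k i) (s : homogeneousSubmodule (Fin 4) k j),
        (i : ℤ) = j + d ∧ s.1 ∉ x.asHomogeneousIdeal ∧ r.1 * q' = p' * s.1 := by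
    intro x
    obtain ⟨i, j, r, s, hij, hs, h⟩ := H x
    exact ⟨i, j, r, s, hij, hs, mul_left_cancel₀ hg (by linear_combination h)⟩
  have hunit : IsUnit q' := by
    by_contra hu
    obtain ⟨t, ht', htq⟩ := WfDvdMonoid.exists_irreducible_factor hu hq'
    have ht : Prime t := ht'.prime
    obtain ⟨i, hi⟩ := exists_X_not_dvd t ht
    obtain ⟨x, hx⟩ := exists_point_of_prime (Ideal.span {t})
      ((Ideal.span_singleton_prime ht.ne_zero).mpr ht) i (by rwa [Ideal.mem_span_singleton])
    obtain ⟨i, j, r, s, hij, hs, h⟩ := H' x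
    refine hs (hx j s.1 s.2 (Ideal.mem_span_singleton.mpr ?_))
    refine (ht.dvd_or_dvd (h ▸ htq.mul_left r.1 : t ∣ p' * s.1)).resolve_left fun htp => ?_
    exact ht.not_isUnit (hrel htp htq)
  obtain ⟨w, hw⟩ := hunit.exists_right_inv
  obtain ⟨x, -⟩ := exists_point_of_prime (⊥ : Ideal (MvPolynomial (Fin 4) k)) Ideal.isPrime_bot 0
    (by simp)
  obtain ⟨i, j, r, s, hij, hs, h⟩ := H' x
  have hs0 : s.1 ≠ 0 := fun h0 => hs (h0 ▸ zero_mem _)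
  have hr : r.1 = (p' * w) * s.1 := by linear_combination w * h - r.1 * hw
  have hp' : p' = p' * w * q' := by linear_combination -p' * hw
  rcases eq_or_ne (p' * w) 0 with h0 | h0
  · refine ⟨0, ?_, fun _ => rfl⟩
    rw [hp', h0]
    simp
  · have hdeg := totalDegree_mul_of_isDomain h0 hs0
    have hr0 : r.1 ≠ 0 := hr ▸ mul_ne_zero h0 hs0
    rw [← hr, ((mem_homogeneousSubmodule _ _).mp r.2).totalDegree hr0,
      ((mem_homogeneousSubmodule _ _).mp s.2).totalDegree hs0] at hdeg
    have hz : (p' * w).totalDegree = 0 := by omega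
    refine ⟨coeff 0 (p' * w), ?_, fun hd => by omega⟩
    rw [← totalDegree_eq_zero_iff_eq_C.mp hz]
    linear_combination g * hp'

end Points

section GenericPoint

open MvPolynomial

variable (k : Type u) [Field k]

/-- The generic point of projective three-space, given by the zero ideal. -/
def genericPt : ProjectiveSpectrum (homogeneousSubmodule (Fin 4) k) where
  asHomogeneousIdeal := ⊥
  isPrime := Ideal.isPrime_bot
  not_irrelevant_le h := by
    have hX : X 0 ∈ HomogeneousIdeal.irrelevant (homogeneousSubmodule (Fin 4) k) := by
      rw [HomogeneousIdeal.mem_irrelevant_iff, GradedRing.proj_apply]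
      exact DirectSum.decompose_of_mem_ne _
        ((mem_homogeneousSubmodule 1 _).mpr (isHomogeneous_X k 0)) one_ne_zero
    exact X_ne_zero (R := k) (0 : Fin 4) (h hX)

/-- The function field of affine four-space, as the localization at the generic point. -/
abbrev GenericRing : Type u := LocalRingAt (homogeneousSubmodule (Fin 4) k) (genericPt k)

variable {k}

lemma mem_genericPt {p : MvPolynomial (Fin 4) k} :
    p ∈ (genericPt k).asHomogeneousIdeal ↔ p = 0 := Iff.rfl

lemma genericPt_primeCompl_le :
    (genericPt k).asHomogeneousIdeal.toIdeal.primeCompl ≤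
      nonZeroDivisors (MvPolynomial (Fin 4) k) :=
  fun _ hs => mem_nonZeroDivisors_of_ne_zero fun h0 => hs (mem_genericPt.mpr h0)

instance : IsDomain (GenericRing k) :=
  IsLocalization.isDomain_localization genericPt_primeCompl_le

lemma algebraMap_genericRing_injective :
    Function.Injective (algebraMap (MvPolynomial (Fin 4) k) (GenericRing k)) :=
  IsLocalization.injective _ genericPt_primeCompl_le

lemma genericPt_mem {U : Opens (ProjectiveSpectrum.top (homogeneousSubmodule (Fin 4) k))}
    {x : ProjectiveSpectrum (homogeneousSubmodule (Fin 4) k)} (hx : x ∈ U) : genericPt k ∈ U := by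
  obtain ⟨_, ⟨f, rfl⟩, hxf, hfU⟩ :=
    (ProjectiveSpectrum.isTopologicalBasis_basic_opens
      (homogeneousSubmodule (Fin 4) k)).exists_subset_of_mem_open hx U.isOpen
  exact hfU fun h0 => hxf (mem_genericPt.mp h0 ▸ zero_mem _)

variable {d : ℤ} {U : (P3 k).Opens}

/-- A section of `𝒪(d)` as a family of elements of the localizations. -/
def toTwistSections : Γ(lineBundle k d, U) →+
    twistSections (𝒜 := homogeneousSubmodule (Fin 4) k) d U :=
  AddMonoidHom.id (twistSections (𝒜 := homogeneousSubmodule (Fin 4) k) d U)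

lemma section_ext {f g : Γ(lineBundle k d, U)}
    (h : ∀ x, (toTwistSections f).1 x = (toTwistSections g).1 x) : f = g :=
  Subtype.ext (funext h)

/-- The value of a section of `𝒪(d)` at the generic point. -/
def genericValue (hU : genericPt k ∈ U) : Γ(lineBundle k d, U) →+ GenericRing k where
  toFun f := (toTwistSections f).1 ⟨genericPt k, hU⟩
  map_zero' := rfl
  map_add' _ _ := rfl

@[simp]
lemma genericValue_map {V : (P3 k).Opens} (i : V ⟶ U) (hV : genericPt k ∈ V)
    (f : Γ(lineBundle k d, U)) :
    genericValue hV ((lineBundle k d).presheaf.map i.op f) = genericValue (i.le hV) f := rfl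

/-- The value at the generic point of a section of the structure sheaf. -/
def genericScalar (hU : genericPt k ∈ U) (c : Γ(P3 k, U)) : GenericRing k :=
  ((show (ProjectiveSpectrum.Proj.structureSheaf (homogeneousSubmodule (Fin 4) k)).1.obj (op U)
    from c).1 ⟨genericPt k, hU⟩).val

lemma genericValue_smul (hU : genericPt k ∈ U) (c : Γ(P3 k, U)) (f : Γ(lineBundle k d, U)) :
    genericValue hU (c • f) = genericScalar hU c * genericValue hU f := rfl

/-- Near a point a section is a fraction, also at the generic point. -/
lemma exists_fraction (f : Γ(lineBundle k d, U)) (x : ProjectiveSpectrum.top _) (hx : x ∈ U) :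
    ∃ (i j : ℕ) (r : homogeneousSubmodule (Fin 4) k i) (s : homogeneousSubmodule (Fin 4) k j)
      (hs : s.1 ∉ x.asHomogeneousIdeal), (i : ℤ) = j + d ∧
      (toTwistSections f).1 ⟨x, hx⟩ = Localization.mk r.1 ⟨s.1, hs⟩ ∧
      genericValue (genericPt_mem hx) f * algebraMap _ (GenericRing k) s.1 =
        algebraMap _ (GenericRing k) r.1 := by
  obtain ⟨V, hxV, hVU, i, j, hij, r, s, hs, h⟩ := (toTwistSections f).2 ⟨x, hx⟩
  refine ⟨i, j, r, s, hs ⟨x, hxV⟩, hij, h ⟨x, hxV⟩, ?_⟩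
  have h2 := h ⟨genericPt k, genericPt_mem hxV⟩
  have h3 : genericValue (genericPt_mem hx) f =
      Localization.mk r.1 ⟨s.1, hs ⟨genericPt k, genericPt_mem hxV⟩⟩ := h2
  rw [h3, ← Localization.mk_one_eq_algebraMap, ← Localization.mk_one_eq_algebraMap,
    Localization.mk_mul, Localization.mk_eq_mk_iff, Localization.r_iff_exists]
  exact ⟨1, by simp [mul_comm]⟩

/-- A section of `𝒪(d)` is determined by its value at the generic point. -/
lemma eq_zero_of_genericValue_eq_zero (hU : genericPt k ∈ U) {f : Γ(lineBundle k d, U)}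
    (h : genericValue hU f = 0) : f = 0 := by
  refine section_ext fun x => ?_
  obtain ⟨i, j, r, s, hs, hij, h1, h2⟩ := exists_fraction f x.1 x.2
  rw [h, zero_mul] at h2
  have hr : r.1 = 0 := algebraMap_genericRing_injective (by rw [← h2, map_zero])
  refine h1.trans ?_
  rw [hr, Localization.mk_zero]
  rfl

lemma genericValue_injective (hU : genericPt k ∈ U) :
    Function.Injective (genericValue hU (d := d)) :=
  (injective_iff_map_eq_zero _).mpr fun _ => eq_zero_of_genericValue_eq_zero hU

lemma genericPt_mem_of_ne_zero {f : Γ(lineBundle k d, U)} (hf : f ≠ 0) : genericPt k ∈ U := by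
  by_contra hU
  exact hf (section_ext fun x => (hU (genericPt_mem x.2)).elim)

/-- A form of degree `n` as a global section of `𝒪(n)`. -/
def formSection {n : ℕ} (p : homogeneousSubmodule (Fin 4) k n) (hn : (n : ℤ) = d)
    (U : (P3 k).Opens) : Γ(lineBundle k d, U) :=
  show twistSections (𝒜 := homogeneousSubmodule (Fin 4) k) d U from
  ⟨fun x => Localization.mk p.1 1, fun x => ⟨U, x.2, 𝟙 _, n, 0, by simpa using hn, p,
    ⟨1, (mem_homogeneousSubmodule _ _).mpr (isHomogeneous_one _ _)⟩,
    fun y => fun h => y.1.isPrime.ne_top ((Ideal.eq_top_iff_one _).mpr h), fun _ => rfl⟩⟩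

lemma genericValue_formSection {n : ℕ} (p : homogeneousSubmodule (Fin 4) k n) (hn : (n : ℤ) = d)
    (hU : genericPt k ∈ U) :
    genericValue hU (formSection p hn U) = algebraMap _ (GenericRing k) p.1 := rfl

/-- A fraction of forms of the same degree as a section of the structure sheaf. -/
def fractionSection {n : ℕ} (r s : homogeneousSubmodule (Fin 4) k n)
    (hs : ∀ x : ProjectiveSpectrum.top _, x ∈ U → s.1 ∉ x.asHomogeneousIdeal) : Γ(P3 k, U) :=
  show (ProjectiveSpectrum.Proj.structureSheaf (homogeneousSubmodule (Fin 4) k)).1.obj (op U) from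
  ⟨fun x => HomogeneousLocalization.mk ⟨n, r, s, hs x.1 x.2⟩,
    fun x => ⟨U, x.2, 𝟙 _, n, r, s, fun y => hs y.1 y.2, fun _ => rfl⟩⟩

lemma genericScalar_fractionSection {n : ℕ} (r s : homogeneousSubmodule (Fin 4) k n)
    (hs : ∀ x : ProjectiveSpectrum.top _, x ∈ U → s.1 ∉ x.asHomogeneousIdeal)
    (hU : genericPt k ∈ U) :
    genericScalar hU (fractionSection r s hs) * algebraMap _ (GenericRing k) s.1 =
      algebraMap _ (GenericRing k) r.1 := by
  have h : genericScalar hU (fractionSection r s hs) =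
      Localization.mk r.1 ⟨s.1, hs _ hU⟩ := HomogeneousLocalization.val_mk _
  rw [h, ← Localization.mk_one_eq_algebraMap, ← Localization.mk_one_eq_algebraMap,
    Localization.mk_mul, Localization.mk_eq_mk_iff, Localization.r_iff_exists]
  exact ⟨1, by simp [mul_comm]⟩

/-- Sections of the same twist are proportional on a smaller open set. -/
lemma exists_smul_eq (hU : genericPt k ∈ U) {f : Γ(lineBundle k d, U)} (hf : f ≠ 0)
    (g : Γ(lineBundle k d, U)) :
    ∃ (W : (P3 k).Opens) (i : W ⟶ U) (_ : genericPt k ∈ W) (c : Γ(P3 k, W)),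
      (lineBundle k d).presheaf.map i.op g = c • (lineBundle k d).presheaf.map i.op f := by
  obtain ⟨i, j, r, s, hs, hij, -, h⟩ := exists_fraction f _ hU
  obtain ⟨i', j', r', s', hs', hij', -, h'⟩ := exists_fraction g _ hU
  have hr : r.1 ≠ 0 := by
    intro h0
    rw [h0, map_zero, mul_eq_zero] at h
    rcases h with h | h
    · exact hf (eq_zero_of_genericValue_eq_zero _ h)
    · exact hs (mem_genericPt.mpr (algebraMap_genericRing_injective (h.trans (map_zero _).symm)))
  let W : (P3 k).Opens := U ⊓ ProjectiveSpectrum.basicOpen _ (s'.1 * r.1)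
  have hn : s'.1 * r.1 ∉ (genericPt k).asHomogeneousIdeal := fun h0 => by
    rcases mul_eq_zero.mp (mem_genericPt.mp h0) with h0 | h0
    · exact hs' (mem_genericPt.mpr h0)
    · exact hr h0
  have hW : genericPt k ∈ W := ⟨hU, hn⟩
  have hdeg : i' + j = j' + i := by omega
  refine ⟨W, homOfLE inf_le_left, hW,
    fractionSection ⟨r'.1 * s.1, SetLike.mul_mem_graded r'.2 s.2⟩
      ⟨s'.1 * r.1, hdeg ▸ SetLike.mul_mem_graded s'.2 r.2⟩ fun x hx => hx.2, ?_⟩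
  refine genericValue_injective hW ?_
  have hc := genericScalar_fractionSection (U := W)
    ⟨r'.1 * s.1, SetLike.mul_mem_graded r'.2 s.2⟩
    ⟨s'.1 * r.1, hdeg ▸ SetLike.mul_mem_graded s'.2 r.2⟩ (fun x hx => hx.2) hW
  rw [genericValue_smul, genericValue_map, genericValue_map]
  have hne : algebraMap _ (GenericRing k) (s'.1 * r.1) ≠ 0 := fun h0 =>
    hn (mem_genericPt.mpr (algebraMap_genericRing_injective (h0.trans (map_zero _).symm)))
  refine mul_right_cancel₀ hne ?_
  simp only [map_mul] at hc ⊢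
  linear_combination algebraMap _ (GenericRing k) r.1 * h' - algebraMap _ (GenericRing k) r'.1 * h
    - genericValue hU f * hc

end GenericPoint

section Rigidity

open MvPolynomial

variable {k : Type u} [Field k]

/-- If a section `g` of `𝒪(n)` is a rational multiple of a nonzero section `f` of `𝒪(m)`, where
`n ≤ m` and the multiple is regular everywhere, then it is a constant multiple,
and zero if `n < m`. -/
lemma genericValue_eq_C_mul {m n : ℤ} (hnm : n ≤ m) {U V : (P3 k).Opens} (hU : genericPt k ∈ U)
    (hV : genericPt k ∈ V)
    (f : Γ(lineBundle k m, U)) (hf : f ≠ 0) (g : Γ(lineBundle k n, V))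
    (H : ∀ x : ProjectiveSpectrum.top (homogeneousSubmodule (Fin 4) k),
      ∃ (W : (P3 k).Opens) (hx : x ∈ W) (y : Γ(lineBundle k n, W)) (l : ℕ)
        (ξ : homogeneousSubmodule (Fin 4) k l), (l : ℤ) = m ∧ ξ.1 ∉ x.asHomogeneousIdeal ∧
        genericValue (genericPt_mem hx) y * genericValue hU f =
          genericValue hV g * algebraMap _ (GenericRing k) ξ.1) :
    ∃ c : k, genericValue hV g = algebraMap (MvPolynomial (Fin 4) k) (GenericRing k) (C c) * genericValue hU f ∧
      (n < m → g = 0) := by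
  obtain ⟨i, j, r, s, hs, hij, -, h⟩ := exists_fraction f _ hU
  obtain ⟨i', j', r', s', hs', hij', -, h'⟩ := exists_fraction g _ hV
  have key {p : MvPolynomial (Fin 4) k} (hp : p ≠ 0) : algebraMap _ (GenericRing k) p ≠ 0 :=
    fun h0 => hp (algebraMap_genericRing_injective (h0.trans (map_zero _).symm))
  have hs0 : s.1 ≠ 0 := fun h0 => hs (mem_genericPt.mpr h0)
  have hs0' : s'.1 ≠ 0 := fun h0 => hs' (mem_genericPt.mpr h0)
  have hf0 : genericValue hU f ≠ 0 := fun h0 => hf (eq_zero_of_genericValue_eq_zero _ h0)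
  have hr0 : r.1 ≠ 0 := by
    intro h0
    rw [h0, map_zero] at h
    exact mul_ne_zero hf0 (key hs0) h
  obtain ⟨c, hc, hc0⟩ := eq_C_mul_of_forall_point (r'.1 * s.1) (r.1 * s'.1)
    (mul_ne_zero hr0 hs0') (n - m) (by omega) fun x => by
      obtain ⟨W, hx, y, l, ξ, hl, hξ, hy⟩ := H x
      obtain ⟨i₁, j₁, r₁, s₁, hs₁, hij₁, -, h₁⟩ := exists_fraction y x hx
      refine ⟨i₁, l + j₁, r₁, ⟨ξ.1 * s₁.1, SetLike.mul_mem_graded ξ.2 s₁.2⟩, by push_cast; omega,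
        x.isPrime.mul_notMem hξ hs₁, algebraMap_genericRing_injective ?_⟩
      refine mul_left_cancel₀ hf0 ?_
      simp only [map_mul]
      rw [← h₁, ← h, ← h']
      linear_combination genericValue hU f * algebraMap _ (GenericRing k) s.1 *
        algebraMap _ (GenericRing k) s'.1 * algebraMap _ (GenericRing k) s₁.1 * hy
  have hc' := congrArg (algebraMap _ (GenericRing k)) hc
  simp only [map_mul] at hc'
  rw [← h, ← h'] at hc'
  have hval : genericValue hV g = algebraMap (MvPolynomial (Fin 4) k) (GenericRing k) (C c) * genericValue hU f :=
    mul_right_cancel₀ (mul_ne_zero (key hs0) (key hs0')) (by linear_combination hc')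
  refine ⟨c, hval, fun hlt => eq_zero_of_genericValue_eq_zero hV ?_⟩
  rw [hval, hc0 (by omega), map_zero, map_zero, zero_mul]

/-- A morphism of line bundles multiplies all sections by the same rational function. -/
lemma genericValue_app_mul {m n : ℤ} (χ : lineBundle k m ⟶ lineBundle k n) {U V : (P3 k).Opens}
    (hU : genericPt k ∈ U) (hV : genericPt k ∈ V)
    (f : Γ(lineBundle k m, U)) (g : Γ(lineBundle k m, V)) (hf : f ≠ 0) :
    genericValue hV (χ.app V g) * genericValue hU f =
      genericValue hU (χ.app U f) * genericValue hV g := by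
  have hUV : genericPt k ∈ U ⊓ V := ⟨hU, hV⟩
  let iU : U ⊓ V ⟶ U := homOfLE inf_le_left
  let iV : U ⊓ V ⟶ V := homOfLE inf_le_right
  have hf' : (lineBundle k m).presheaf.map iU.op f ≠ 0 := fun h0 => hf
    (eq_zero_of_genericValue_eq_zero hU (by
      rw [← genericValue_map iU hUV f, h0, map_zero]))
  obtain ⟨W, i, hW, c, hc⟩ := exists_smul_eq hUV hf' ((lineBundle k m).presheaf.map iV.op g)
  have h1 := congrArg (genericValue hW) hc
  have h2 := congrArg (fun t => genericValue hW (χ.app W t)) hc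
  simp only [Scheme.Modules.Hom.app_smul, app_map, genericValue_smul, genericValue_map] at h1 h2
  rw [h1, h2]
  ring

/-- A morphism from `𝒪(m)`, `0 ≤ m`, to `𝒪(n)` with `n ≤ m` is zero or an isomorphism. -/
lemma eq_zero_of_not_isIso {m n : ℤ} (hm : 0 ≤ m) (hnm : n ≤ m)
    (χ : lineBundle k m ⟶ lineBundle k n) (hχ : ¬ IsIso χ) : χ = 0 := by
  lift m to ℕ using hm
  obtain ⟨ξ, hξ⟩ := exists_form_notMem (genericPt k) m
  have hT : genericPt k ∈ (⊤ : (P3 k).Opens) := trivial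
  let f : Γ(lineBundle k m, ⊤) := formSection ξ rfl ⊤
  have hf0 : genericValue hT f ≠ 0 := fun h0 => hξ (mem_genericPt.mpr
    (algebraMap_genericRing_injective (h0.trans (map_zero _).symm)))
  have hf : f ≠ 0 := fun h0 => hf0 (by rw [h0, map_zero])
  obtain ⟨c, hc, hc0⟩ := genericValue_eq_C_mul hnm hT hT f hf (χ.app ⊤ f) fun x => by
    obtain ⟨ξ', hξ'⟩ := exists_form_notMem x m
    exact ⟨⊤, trivial, χ.app ⊤ (formSection ξ' rfl ⊤), m, ξ', rfl, hξ',
      genericValue_app_mul χ hT hT f _ hf⟩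
  have hval {U : (P3 k).Opens} (hU : genericPt k ∈ U) (g : Γ(lineBundle k m, U)) :
      genericValue hU (χ.app U g) = algebraMap (MvPolynomial (Fin 4) k) (GenericRing k) (C c) * genericValue hU g := by
    have := genericValue_app_mul χ hT hU f g hf
    rw [hc] at this
    exact mul_right_cancel₀ hf0 (by linear_combination this)
  have hzero (h0 : c = 0) : χ = 0 := by
    ext U g
    by_cases hU : genericPt k ∈ U
    · refine genericValue_injective hU ((hval hU g).trans ?_)
      rw [h0, map_zero, map_zero, zero_mul]
      exact (map_zero _).symm
    · exact section_ext fun x => (hU (genericPt_mem x.2)).elim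
  rcases hnm.lt_or_eq with hlt | rfl
  · refine hzero ?_
    by_contra h0
    rw [hc0 hlt, map_zero] at hc
    refine mul_ne_zero (fun h => h0 ?_) hf0 hc.symm
    exact C_injective _ _ ((algebraMap_genericRing_injective
      (h.trans (map_zero _).symm)).trans (map_zero _).symm)
  · by_contra hne
    have hc1 : c ≠ 0 := fun h0 => hne (hzero h0)
    refine hχ (Scheme.Modules.Hom.isIso_iff_isIso_app.mpr fun U => ?_)
    rw [ConcreteCategory.isIso_iff_bijective]
    by_cases hU : genericPt k ∈ U
    · let e (c : k) : homogeneousSubmodule (Fin 4) k 0 :=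
        ⟨C c, (mem_homogeneousSubmodule _ _).mpr (isHomogeneous_C _ _)⟩
      have hCC : C c⁻¹ * C c = (1 : MvPolynomial (Fin 4) k) := by
        rw [← C_mul, inv_mul_cancel₀ hc1, C_1]
      have hCK : algebraMap (MvPolynomial (Fin 4) k) (GenericRing k) (C c⁻¹) *
          algebraMap (MvPolynomial (Fin 4) k) (GenericRing k) (C c) = 1 := by
        rw [← map_mul, hCC, map_one]
      have he : ∀ x : ProjectiveSpectrum.top _, x ∈ U → (e c).1 ∉ x.asHomogeneousIdeal :=
        fun x _ hx => x.isPrime.ne_top ((Ideal.eq_top_iff_one _).mpr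
          (hCC ▸ Ideal.mul_mem_left _ _ hx))
      refine ⟨fun g₁ g₂ h => genericValue_injective hU ?_, fun g =>
        ⟨fractionSection (e 1) (e c) he • g, genericValue_injective hU ?_⟩⟩
      · have := congrArg (genericValue hU) h
        rw [hval hU, hval hU] at this
        linear_combination algebraMap (MvPolynomial (Fin 4) k) (GenericRing k) (C c⁻¹) * this -
          (genericValue hU g₁ - genericValue hU g₂) * hCK
      · refine (hval hU _).trans ?_
        rw [genericValue_smul]
        have := genericScalar_fractionSection (e 1) (e c) he hU
        have h1 : algebraMap _ (GenericRing k) (e 1).1 = 1 := by simp [e]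
        rw [h1] at this
        linear_combination genericValue hU g * this
    · exact ⟨fun _ _ _ => section_ext fun x => (hU (genericPt_mem x.2)).elim,
        fun _ => ⟨0, section_ext fun x => (hU (genericPt_mem x.2)).elim⟩⟩

end Rigidity

section Main

open MvPolynomial

variable {k : Type u} [Field k]

/-- A section of `𝒪(m)`, `0 ≤ m`, and one of a sum of line bundles of smaller degree have the same
image in a third bundle only if this image is zero, when the second map is locally left
invertible. -/
lemma app_eq_zero_of_eq {m : ℤ} (hm : 0 ≤ m) {s : ℕ} {d : Fin s → ℤ} (hd : ∀ i, d i < m)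
    {N : (P3 k).Modules} (α : (⨁ fun i => lineBundle k (d i)) ⟶ N)
    (hα : IsLocallyLeftInvertible α) (φ : lineBundle k m ⟶ N) {U : (P3 k).Opens}
    (f : Γ(lineBundle k m, U)) (g : Γ(⨁ fun i => lineBundle k (d i), U))
    (hfg : φ.app U f = α.app U g) : φ.app U f = 0 := by
  rcases eq_or_ne f 0 with rfl | hf
  · exact map_zero _
  rw [hfg]
  have hU := genericPt_mem_of_ne_zero hf
  lift m to ℕ using hm
  suffices hg : g = 0 by rw [hg, map_zero]
  refine biproduct_section_eq_zero _ _ fun i => ?_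
  let π := biproduct.π (fun i => lineBundle k (d i)) i
  obtain ⟨c, -, h0⟩ := genericValue_eq_C_mul (hd i).le hU hU f hf (π.app U g) fun x => by
    obtain ⟨V, hx, ρ, hρα, hρc, hρ⟩ := hα.exists_retraction x
    obtain ⟨ξ, hξ⟩ := exists_form_notMem x m
    have hxW : x ∈ V.ι ''ᵁ ⊤ := V.ι_image_top.ge hx
    let z : Γ(lineBundle k m, V.ι ''ᵁ ⊤) := formSection ξ rfl _
    refine ⟨V.ι ''ᵁ ⊤, hxW, π.app _ (ρ ⊤ (φ.app _ z)), m, ξ, rfl, hξ, ?_⟩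
    have hV : genericPt k ∈ V.ι ''ᵁ ⊤ := genericPt_mem hxW
    have hUV : genericPt k ∈ U ⊓ V.ι ''ᵁ ⊤ := ⟨hU, hV⟩
    have hf' : (lineBundle k m).presheaf.map
        (homOfLE inf_le_left : U ⊓ V.ι ''ᵁ ⊤ ⟶ U).op f ≠ 0 := fun h0 => hf
      (eq_zero_of_genericValue_eq_zero hU (by
        rw [← genericValue_map (homOfLE inf_le_left : U ⊓ V.ι ''ᵁ ⊤ ⟶ U) hUV f, h0, map_zero]))
    obtain ⟨W, i₀, hW, c, hc⟩ := exists_smul_eq hUV hf' ((lineBundle k m).presheaf.map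
      (homOfLE inf_le_right : U ⊓ V.ι ''ᵁ ⊤ ⟶ V.ι ''ᵁ ⊤).op z)
    let O : (V : Scheme.{u}).Opens := V.ι ⁻¹ᵁ W
    have hOW : V.ι ''ᵁ O ≤ W := by
      rw [Scheme.Hom.image_preimage_eq_opensRange_inf]
      exact inf_le_right
    have hO : genericPt k ∈ V.ι ''ᵁ O := by
      rw [Scheme.Hom.image_preimage_eq_opensRange_inf]
      exact ⟨V.opensRange_ι.ge (V.ι_image_top.le hV), hW⟩
    let jW : V.ι ''ᵁ O ⟶ W := homOfLE hOW
    let jU : V.ι ''ᵁ O ⟶ U := homOfLE (hOW.trans (i₀.le.trans inf_le_left))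
    let jV : V.ι ''ᵁ O ⟶ V.ι ''ᵁ ⊤ := V.ι.opensFunctor.map (homOfLE le_top)
    let c' : Γ(P3 k, V.ι ''ᵁ O) := (P3 k).presheaf.map jW.op c
    have hz : (lineBundle k m).presheaf.map jV.op z =
        c' • (lineBundle k m).presheaf.map jU.op f := by
      have h1 := congrArg ((lineBundle k m).presheaf.map jW.op) hc
      rw [Scheme.Modules.map_smul] at h1
      exact h1
    have h2 : (lineBundle k (d i)).presheaf.map jV.op (π.app _ (ρ ⊤ (φ.app _ z))) =
        c' • (lineBundle k (d i)).presheaf.map jU.op (π.app U g) := by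
      rw [← app_map, ← hρ, ← app_map φ, hz, Scheme.Modules.Hom.app_smul, hρc, app_map φ jU, hfg,
        ← app_map α, hρα, Scheme.Modules.Hom.app_smul, app_map π jU]
    have h1 := congrArg (genericValue hO) hz
    have h3 := congrArg (genericValue hO) h2
    rw [genericValue_smul, genericValue_map, genericValue_map] at h1 h3
    rw [h3]
    have h4 : genericValue hV z = algebraMap _ (GenericRing k) ξ.1 := rfl
    rw [← h4, h1]
    ring
  exact h0 (hd i)

/-- A line bundle of nonnegative degree embeds into the cokernel of a locally left invertible map
from a sum of line bundles of smaller degree. -/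
lemma mono_comp_cokernel {m : ℤ} (hm : 0 ≤ m) {s : ℕ} {d : Fin s → ℤ} (hd : ∀ i, d i < m)
    {N Q : (P3 k).Modules} (α : (⨁ fun i => lineBundle k (d i)) ⟶ N) [Mono α]
    (hα : IsLocallyLeftInvertible α) (φ : lineBundle k m ⟶ N) [Mono φ] (p : N ⟶ Q)
    (w : α ≫ p = 0) (hp : (ShortComplex.mk α p w).Exact) : Mono (φ ≫ p) := by
  refine Preadditive.mono_of_cancel_zero _ fun {T} h hh => ?_
  let g : T ⟶ ⨁ fun i => lineBundle k (d i) := hp.lift (h ≫ φ) (by simpa using hh)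
  have hg : g ≫ α = h ≫ φ := hp.lift_f (h ≫ φ) (by simpa using hh)
  rw [← cancel_mono φ, zero_comp]
  ext U t
  exact app_eq_zero_of_eq hm hd α hα φ (h.app U t) (g.app U t) congr($(hg.symm).app U t)

end Main

section RankC1

variable {k : Type u} [Field k]

lemma HasRankC1.of_isZero {F : (P3 k).Modules} (hF : IsZero F) : HasRankC1 k F 0 0 := by
  have h := HasRankC1.lineBundle (k := k) 0
  have := HasRankC1.kernel (ShortComplex.mk (0 : F ⟶ HorrocksMonads.lineBundle k 0) (𝟙 _) zero_comp)
    { exact := (ShortComplex.exact_iff_mono _ (by simp)).mpr (by dsimp; infer_instance)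
      mono_f := ⟨fun _ _ _ => hF.eq_of_tgt _ _⟩
      epi_g := by dsimp; infer_instance } h h
  simpa using this

lemma HasRankC1.biprod {F G : (P3 k).Modules} {r c r' c' : ℤ} (hF : HasRankC1 k F r c)
    (hG : HasRankC1 k G r' c') : HasRankC1 k (F ⊞ G) (r + r') (c + c') :=
  HasRankC1.extension (ShortComplex.mk (biprod.inl : F ⟶ F ⊞ G) biprod.snd (by simp))
    (ShortComplex.Splitting.ofHasBinaryBiproduct F G).shortExact hF hG

lemma HasRankC1.biproduct {n : ℕ} (F : Fin n → (P3 k).Modules) {r c : Fin n → ℤ}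
    (h : ∀ i, HasRankC1 k (F i) (r i) (c i)) : HasRankC1 k (⨁ F) (∑ i, r i) (∑ i, c i) := by
  induction n with
  | zero =>
    refine .of_isZero ((IsZero.iff_id_eq_zero _).mpr ?_)
    ext i
    exact i.elim0
  | succ n ih =>
    rw [Fin.sum_univ_succ, Fin.sum_univ_succ]
    let S : ShortComplex (P3 k).Modules := ShortComplex.mk (biproduct.ι F 0)
      (biproduct.lift fun i : Fin n => biproduct.π F i.succ) (by
        refine biproduct.hom_ext _ _ fun i => ?_
        simpa using biproduct.ι_π_ne F (Fin.succ_ne_zero i).symm)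
    have σ : S.Splitting :=
      { r := biproduct.π F 0
        s := biproduct.desc fun i : Fin n => biproduct.ι F i.succ
        f_r := biproduct.ι_π_self F 0
        s_g := by
          refine biproduct.hom_ext' _ _ fun i => biproduct.hom_ext _ _ fun j => ?_
          by_cases hij : i = j
          · subst hij
            simp [S]
          · simp [S, biproduct.ι_π_ne _ hij,
              biproduct.ι_π_ne F (fun h => hij (Fin.succ_injective _ h) : i.succ ≠ j.succ)]
        id := by
          rw [← biproduct.total, Fin.sum_univ_succ]
          simp [S, biproduct.lift_desc] }
    exact .extension S σ.shortExact (h 0) (ih _ fun i => h i.succ)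

variable {s : ℕ} {a : Fin s → ℤ} {b : Fin (s + 1) → ℤ} (M : HorrocksMonad k a b)

lemma HorrocksMonad.hasRankC1_cohomology : HasRankC1 k M.cohomology 2 (-1) := by
  let S := ShortComplex.mk M.α M.β M.comp_eq_zero
  have := M.mono_α
  have := M.epi_β
  have hL : HasRankC1 k S.X₁ _ _ := .biproduct _ fun i => .lineBundle (-a i - 1)
  have hN : HasRankC1 k S.X₂ _ _ :=
    .biproduct _ fun j => .biprod (.lineBundle (b j)) (.lineBundle (-b j - 1))
  have hR : HasRankC1 k S.X₃ _ _ := .biproduct _ fun i => .lineBundle (a i)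
  have hZ := HasRankC1.kernel (ShortComplex.mk S.iCycles S.g S.iCycles_g)
    { exact := ShortComplex.exact_of_f_is_kernel _ S.cyclesIsKernel
      mono_f := by dsimp; infer_instance
      epi_g := this } hN hR
  have : Mono S.toCycles := mono_of_mono_fac S.toCycles_i
  have hE := HasRankC1.quotient (ShortComplex.mk S.toCycles S.homologyπ S.toCycles_comp_homologyπ)
    { exact := ShortComplex.exact_of_g_is_cokernel _ S.homologyIsCokernel
      mono_f := this
      epi_g := by dsimp; infer_instance } hL hZ
  have hr : (∑ _i : Fin (s + 1), (1 + 1 : ℤ)) - (∑ _i : Fin s, (1 : ℤ)) - ∑ _i : Fin s, (1 : ℤ)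
      = 2 := by
    simp
    ring
  have hc : (∑ j, (b j + (-b j - 1))) - (∑ i, a i) - ∑ i, (-a i - 1) = -1 := by
    have hb : ∀ j, b j + (-b j - 1) = -1 := fun j => by ring
    simp only [hb]
    simp [Finset.sum_sub_distrib]
    ring
  rw [hr, hc] at hE
  exact hE

end RankC1

section Final

variable {k : Type u} [Field k] {s : ℕ} {a : Fin s → ℤ} {b : Fin (s + 1) → ℤ}

/-- In each of the excluded pairs some `bⱼ` is positive and at least as large as all `aᵢ`. -/
lemma IsExcludedPair.exists_le (hab : IsExcludedPair a b) : ∃ j, 0 < b j ∧ ∀ i, a i ≤ b j := by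
  cases hab <;> exact ⟨0, by decide, by decide⟩

/-- If `bⱼ` is at least as large as all `aᵢ`, then `𝒪(bⱼ)` embeds into the cohomology of a positive
minimal monad. -/
lemma HorrocksMonad.exists_mono (M : HorrocksMonad k a b) (hpos : M.IsPositive)
    (hmin : M.IsMinimal) (j : Fin (s + 1)) (hj : 0 < b j) (hab : ∀ i, a i ≤ b j) :
    ∃ i : lineBundle k (b j) ⟶ M.cohomology, Mono i := by
  let S := ShortComplex.mk M.α M.β M.comp_eq_zero
  let φ : lineBundle k (b j) ⟶ S.X₂ := biprod.inl ≫
    biproduct.ι (fun j => lineBundle k (b j) ⊞ lineBundle k (-b j - 1)) j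
  have hφ : φ ≫ S.g = 0 := by
    refine biproduct.hom_ext _ _ fun i => ?_
    rw [zero_comp, Category.assoc, Category.assoc]
    exact eq_zero_of_not_isIso hj.le (hab i) _ (hmin.right_inl j i)
  have := M.mono_α
  have hm : Mono (φ ≫ S.pOpcycles) :=
    mono_comp_cokernel hj.le (fun i => by have := hpos i; omega) M.α M.locallyLeftInvertible_α φ
      S.pOpcycles S.f_pOpcycles (ShortComplex.exact_of_g_is_cokernel _ S.opcyclesIsCokernel)
  refine ⟨S.liftCycles φ hφ ≫ S.homologyπ, ?_⟩
  have h : (S.liftCycles φ hφ ≫ S.homologyπ) ≫ S.homologyι = φ ≫ S.pOpcycles := by simp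
  exact mono_of_mono_fac h

end Final

end HorrocksMonads

end

theorem mainTheorem8 (k : Type u) [Field k] {s : ℕ} (a : Fin s → ℤ) (b : Fin (s + 1) → ℤ)
    (hab : HorrocksMonads.IsExcludedPair a b) (M : HorrocksMonads.HorrocksMonad k a b)
    (hpos : M.IsPositive) (hmin : M.IsMinimal) :
    (∃ σ : Γ(M.cohomology, ⊤), σ ≠ 0) ∧ ¬ HorrocksMonads.IsStable k M.cohomology := by
  obtain ⟨j, hj, hle⟩ := hab.exists_le
  obtain ⟨i, hi⟩ := M.exists_mono hpos hmin j hj hle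
  refine ⟨?_, fun hst => ?_⟩
  · obtain ⟨ξ, hξ⟩ := HorrocksMonads.exists_form_notMem (HorrocksMonads.genericPt k) (b j).toNat
    refine ⟨i.app ⊤ (HorrocksMonads.formSection ξ (Int.toNat_of_nonneg hj.le) ⊤), fun h0 => ?_⟩
    have h := HorrocksMonads.app_injective i ⊤ (h0.trans (map_zero (i.app ⊤).hom).symm)
    have hv := congrArg (HorrocksMonads.genericValue (U := ⊤) trivial) h
    have hv' := (HorrocksMonads.genericValue_formSection ξ (Int.toNat_of_nonneg hj.le)
      (U := ⊤) trivial).symm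
      |>.trans (hv.trans (map_zero _))
    exact hξ (HorrocksMonads.mem_genericPt.mpr
      (HorrocksMonads.algebraMap_genericRing_injective (hv'.trans (map_zero _).symm)))
  · have h := hst 2 (-1) M.hasRankC1_cohomology _ i hi 1 (b j) (.lineBundle (b j)) one_pos
      (by norm_num)
    have hb : (0 : ℚ) < b j := by exact_mod_cast hj
    norm_num at h
    linarith
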